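/- Let $n\ge 2$, let $e_1,\dots,e_n$ be the standard basis of Euclidean space $\mathbb R^n$, and consider the root system of type $\mathsf C_n$ (roots $\pm e_i\pm e_j$ for $i\ne j$, and $\pm 2e_i$) with simple roots $\alpha_i=e_i-e_{i+1}$ $(1\le i\le n-1)$, $\alpha_n=2e_n$, highest root $\theta=2e_1$, and coroots $\alpha^\vee=2\alpha/(\alpha,\alpha)$. Let $W_0$ be its Weyl group, $P^\vee$ its coweight lattice (the weight lattice of the dual root system, of type $\mathsf B_n$), and let $\widetilde W=W_0\ltimes P^\vee$ be the extended affine Weyl group of type $\mathsf C_n^{(1)}$, where $p\in P^\vee$ is also written as the translation $t_p$. Let $s_1,\dots,s_n$ be the simple reflections of $W_0$ and $s_0=t_{\theta^\vee}s_\theta$. The group $\widetilde W$ acts on $\mathbb R^n$ by affine transformations, and hence on affine functions; with $\delta=1$ and $\alpha_0=\delta-\theta$, let $\Lambda\subset\widetilde W$ be the group of those elements that permute the simple affine roots $\{\alpha_0,\dots,\alpha_n\}$. Let $\omega_i\in\widetilde W$ $(1\le i\le n)$ be the translation by the $i$-th fundamental coweight, i.e. by $e_1+\dots+e_i$ if $i<n$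 and by $\frac12(e_1+\dots+e_n)$ if $i=n$. For $1\le k\le l\le n$ put $[k,l]=s_ks_{k+1}\cdots s_l$. An expression $w=\lambda s_{i_1}\cdots s_{i_r}$ with $\lambda\in\Lambda$ and $i_1,\dots,i_r\in\{0,\dots,n\}$ is called reduced if $r$ is minimal among all such expressions of $w$. Then there is a unique $\pi_n\in\widetilde W$ such that $\pi_n(\alpha_k)=\alpha_{n-k}$ for all $0\le k\le n$; it lies in $\Lambda$, and $$\omega_n=\pi_n\, s_n\,[n-1,n]\cdots[2,n]\,[1,n],$$ while for $1\le i<n$ $$\omega_i=(s_0[1,n])^i\,[n-i,n-1]\cdots[2,i+1]\,[1,i].$$ Moreover, these formulae yield reduced expressions (for $i<n$ with $\lambda=1$, and for $i=n$ with $\lambda=\pi_n$). -/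

import Mathlib

namespace TypeC

/-- The Euclidean space `ℝⁿ`, identified with its dual by the standard scalar product `dotProduct`. -/
abbrev V (n : ℕ) : Type := Fin n → ℝ

/-- The standard basis vector `e_j`, with `1`-based labels `1 ≤ j ≤ n`. -/
def e (n j : ℕ) : V n := fun m => if m.val + 1 = j then 1 else 0

/-- The root system of type `C_n`: the vectors `± e_i ± e_j` with `i ≠ j`, and `± 2 e_i`. -/
def roots (n : ℕ) : Set (V n) :=
  {v | (∃ i j : ℕ, 1 ≤ i ∧ i ≤ n ∧ 1 ≤ j ∧ j ≤ n ∧ i ≠ j ∧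
          (v = e n i - e n j ∨ v = e n i + e n j ∨ v = -(e n i + e n j))) ∨
       (∃ i : ℕ, 1 ≤ i ∧ i ≤ n ∧ (v = (2 : ℝ) • e n i ∨ v = -((2 : ℝ) • e n i)))}

/-- The simple roots `α_i`, `1 ≤ i ≤ n`: `α_i = e_i - e_{i+1}` for `i < n`, and `α_n = 2 e_n`. -/
def simpleRoot (n i : ℕ) : V n :=
  if i < n then e n i - e n (i + 1) else (2 : ℝ) • e n n

/-- The highest root `θ = 2 α_1 + ⋯ + 2 α_{n-1} + α_n = 2 e_1`. -/
def highestRoot (n : ℕ) : V n := (2 : ℝ) • e n 1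

/-- The coroot `α^∨ = 2 α / (α, α)`. -/
noncomputable def coroot {n : ℕ} (α : V n) : V n := (2 / dotProduct α α) • α

/-- The reflection `x ↦ x - (α, x) α^∨`. -/
noncomputable def reflection {n : ℕ} (α : V n) : V n ≃ₗ[ℝ] V n :=
  LinearEquiv.ofInvolutive
    { toFun := fun x => x - dotProduct α x • coroot α
      map_add' := fun x y => by rw [dotProduct_add, add_smul]; abel
      map_smul' := fun c x => by
        rw [dotProduct_smul, RingHom.id_apply, smul_sub, smul_smul, smul_eq_mul] }
    (fun x => by
      by_cases h : dotProduct α α = 0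
      · simp [coroot, h]
      · have h2 : dotProduct α (coroot α) = 2 := by
          rw [coroot, dotProduct_smul, smul_eq_mul]; field_simp
        change (x - dotProduct α x • coroot α) -
          dotProduct α (x - dotProduct α x • coroot α) • coroot α = x
        rw [dotProduct_sub, dotProduct_smul, h2, smul_eq_mul, ← sub_eq_zero]
        module)

theorem reflection_apply {n : ℕ} (α x : V n) :
    reflection α x = x - dotProduct α x • coroot α := rfl

/-- The finite Weyl group `W_0`. -/
def weylGroup (n : ℕ) : Subgroup (V n ≃ₗ[ℝ] V n) :=
  Subgroup.closure (reflection '' roots n)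

/-- The coweight lattice `P^∨`, i.e. the weight lattice of the dual root system (of type `B_n`). -/
def coweightLattice (n : ℕ) : AddSubgroup (V n) where
  carrier := {p | ∀ α ∈ roots n, ∃ m : ℤ, dotProduct α p = m}
  zero_mem' := fun α _ => ⟨0, by simp⟩
  add_mem' := fun {p q} hp hq α hα => by
    obtain ⟨a, ha⟩ := hp α hα
    obtain ⟨b, hb⟩ := hq α hα
    exact ⟨a + b, by rw [dotProduct_add, ha, hb]; push_cast; rfl⟩
  neg_mem' := fun {p} hp α hα => by
    obtain ⟨a, ha⟩ := hp α hα
    exact ⟨-a, by rw [dotProduct_neg, ha]; push_cast; rfl⟩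

theorem e_dotProduct {n j : ℕ} (h1 : 1 ≤ j) (h2 : j ≤ n) (x : V n) :
    dotProduct (e n j) x = x ⟨j - 1, by omega⟩ := by
  rw [dotProduct, Finset.sum_eq_single (⟨j - 1, by omega⟩ : Fin n)]
  · have : j - 1 + 1 = j := by omega
    simp [e, this]
  · intro b _ hb
    have : ¬ (b.val + 1 = j) := fun h => hb (Fin.ext (by simp; omega))
    simp [e, this]
  · simp

theorem mem_coweightLattice {n : ℕ} (p : V n)
    (h : ∀ i j : Fin n, ∃ m : ℤ, p i + p j = m) : p ∈ coweightLattice n := by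
  rintro α (⟨i, j, hi, hi', hj, hj', -, h'⟩ | ⟨i, hi, hi', h'⟩)
  · obtain ⟨a, ha⟩ := h ⟨i - 1, by omega⟩ ⟨j - 1, by omega⟩
    obtain ⟨b, hb⟩ := h ⟨j - 1, by omega⟩ ⟨j - 1, by omega⟩
    rcases h' with rfl | rfl | rfl
    · exact ⟨a - b, by
        rw [sub_dotProduct, e_dotProduct hi hi', e_dotProduct hj hj']; push_cast; linarith⟩
    · exact ⟨a, by rw [add_dotProduct, e_dotProduct hi hi', e_dotProduct hj hj', ha]⟩
    · exact ⟨-a, by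
        rw [neg_dotProduct, add_dotProduct, e_dotProduct hi hi', e_dotProduct hj hj', ha]
        push_cast; rfl⟩
  · obtain ⟨a, ha⟩ := h ⟨i - 1, by omega⟩ ⟨i - 1, by omega⟩
    rcases h' with rfl | rfl
    · exact ⟨a, by rw [smul_dotProduct, e_dotProduct hi hi', smul_eq_mul]; linarith⟩
    · exact ⟨-a, by
        rw [neg_dotProduct, smul_dotProduct, e_dotProduct hi hi', smul_eq_mul]
        push_cast; linarith⟩

theorem e_apply_int (n j : ℕ) (m : Fin n) : ∃ k : ℤ, e n j m = k := by
  unfold e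
  split_ifs
  · exact ⟨1, by simp⟩
  · exact ⟨0, by simp⟩

theorem coroot_apply_int {n : ℕ} {α : V n} (hα : α ∈ roots n) (m : Fin n) :
    ∃ k : ℤ, coroot α m = k := by
  have he : ∀ i j : ℕ, 1 ≤ i → i ≤ n → dotProduct (e n i) (e n j) = if i = j then 1 else 0 := by
    intro i j h1 h2
    rw [e_dotProduct h1 h2]
    have : i - 1 + 1 = i := by omega
    simp [e, this]
  rcases hα with ⟨i, j, hi, hi', hj, hj', hij, h'⟩ | ⟨i, hi, hi', h'⟩
  · obtain ⟨a, ha⟩ := e_apply_int n i m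
    obtain ⟨b, hb⟩ := e_apply_int n j m
    have h1 := he i i hi hi'
    have h2 := he i j hi hi'
    have h3 := he j i hj hj'
    have h4 := he j j hj hj'
    rw [if_pos rfl] at h1 h4
    rw [if_neg hij] at h2
    rw [if_neg (Ne.symm hij)] at h3
    rcases h' with rfl | rfl | rfl
    · refine ⟨a - b, ?_⟩
      simp [coroot, sub_dotProduct, dotProduct_sub, h1, h2, h3, h4, ha, hb]
      norm_num
    · refine ⟨a + b, ?_⟩
      simp [coroot, add_dotProduct, dotProduct_add, h1, h2, h3, h4, ha, hb]
      norm_num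
    · refine ⟨-(a + b), ?_⟩
      simp [coroot, add_dotProduct, dotProduct_add, h1, h2, h3, h4, ha, hb]
      norm_num
      try ring
  · obtain ⟨a, ha⟩ := e_apply_int n i m
    have h1 := he i i hi hi'
    rw [if_pos rfl] at h1
    rcases h' with rfl | rfl
    · refine ⟨a, ?_⟩
      simp [coroot, h1, ha]
    · refine ⟨-a, ?_⟩
      simp [coroot, h1, ha]

theorem coroot_mem {n : ℕ} {α : V n} (hα : α ∈ roots n) : coroot α ∈ coweightLattice n :=
  mem_coweightLattice _ fun i j => by
    obtain ⟨a, ha⟩ := coroot_apply_int hα i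
    obtain ⟨b, hb⟩ := coroot_apply_int hα j
    exact ⟨a + b, by rw [ha, hb]; push_cast; rfl⟩

theorem weylGroup_apply_mem {n : ℕ} {w : V n ≃ₗ[ℝ] V n} (hw : w ∈ weylGroup n) :
    ∀ p ∈ coweightLattice n, w p ∈ coweightLattice n := by
  have key : ∀ α ∈ roots n, ∀ p ∈ coweightLattice n, reflection α p ∈ coweightLattice n := by
    intro α hα p hp
    obtain ⟨a, ha⟩ := hp α hα
    rw [reflection_apply, ha, Int.cast_smul_eq_zsmul]
    exact sub_mem hp (zsmul_mem (coroot_mem hα) a)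
  have hinv : ∀ α : V n, (reflection α)⁻¹ = reflection α := fun α => by
    ext x : 1
    rfl
  refine Subgroup.closure_induction'' (p := fun w _ => ∀ p ∈ coweightLattice n,
    w p ∈ coweightLattice n) ?_ ?_ ?_ ?_ hw
  · rintro _ ⟨α, hα, rfl⟩; exact key α hα
  · rintro _ ⟨α, hα, rfl⟩; rw [hinv]; exact key α hα
  · intro p hp; exact hp
  · intro x y _ _ hx hy p hp; exact hx _ (hy p hp)

/-- The action of `W_0` on `P^∨` (written multiplicatively). -/
def weylAction (n : ℕ) : weylGroup n →* MulAut (Multiplicative (coweightLattice n)) where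
  toFun w := AddEquiv.toMultiplicative
    { toFun := fun p => ⟨w.1 p.1, weylGroup_apply_mem w.2 p.1 p.2⟩
      invFun := fun p => ⟨w⁻¹.1 p.1, weylGroup_apply_mem w⁻¹.2 p.1 p.2⟩
      left_inv := fun p => Subtype.ext (LinearEquiv.symm_apply_apply w.1 p.1)
      right_inv := fun p => Subtype.ext (LinearEquiv.apply_symm_apply w.1 p.1)
      map_add' := fun p q => Subtype.ext (map_add w.1 p.1 q.1) }
  map_one' := rfl
  map_mul' _ _ := rfl

/-- The extended affine Weyl group `W_0 ⋉ P^∨` of type `C_n^(1)`.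
The element `⟨p, w⟩` is `t_p w`, the affine transformation `x ↦ w x + p`. -/
abbrev ExtAffineWeyl (n : ℕ) : Type :=
  Multiplicative (coweightLattice n) ⋊[weylAction n] weylGroup n

/-- The translation `t_p`. -/
def translation {n : ℕ} (p : coweightLattice n) : ExtAffineWeyl n :=
  SemidirectProduct.inl (Multiplicative.ofAdd p)

theorem reflection_mem_weylGroup {n : ℕ} {α : V n} (hα : α ∈ roots n) :
    reflection α ∈ weylGroup n :=
  Subgroup.subset_closure ⟨α, hα, rfl⟩

theorem simpleRoot_mem {n i : ℕ} (h1 : 1 ≤ i) (h2 : i ≤ n) : simpleRoot n i ∈ roots n := by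
  unfold simpleRoot
  split_ifs with h
  · exact Or.inl ⟨i, i + 1, h1, h2, by omega, by omega, by omega, Or.inl rfl⟩
  · exact Or.inr ⟨n, by omega, le_rfl, Or.inl rfl⟩

theorem highestRoot_mem {n : ℕ} (h : 1 ≤ n) : highestRoot n ∈ roots n :=
  Or.inr ⟨1, le_rfl, h, Or.inl rfl⟩

theorem highestRoot_eq {n : ℕ} (h : 1 ≤ n) :
    highestRoot n = simpleRoot n n + (2 : ℝ) • ∑ i ∈ Finset.Ico 1 n, simpleRoot n i := by
  have : ∑ i ∈ Finset.Ico 1 n, simpleRoot n i = e n 1 - e n n := by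
    rw [Finset.sum_congr rfl (g := fun i => -(e n (i + 1) - e n i))]
    · rw [Finset.sum_neg_distrib, Finset.sum_Ico_sub _ h]; abel
    · intro i hi
      rw [simpleRoot, if_pos (Finset.mem_Ico.mp hi).2]; abel
  rw [this, simpleRoot, if_neg (lt_irrefl n), highestRoot]
  module

/-- The simple reflections `s_0, …, s_n`: `s_i` is the reflection in `α_i` for `1 ≤ i ≤ n`, and
`s_0 = t_{θ^∨} s_θ` (for `n ≥ 1`). -/
noncomputable def s {n : ℕ} (i : Fin (n + 1)) : ExtAffineWeyl n :=
  if hn : 1 ≤ n then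
    if hi : i.val = 0 then
      translation ⟨coroot (highestRoot n), coroot_mem (highestRoot_mem hn)⟩ *
        SemidirectProduct.inr
          ⟨reflection (highestRoot n), reflection_mem_weylGroup (highestRoot_mem hn)⟩
    else
      SemidirectProduct.inr
        ⟨reflection (simpleRoot n i.val),
          reflection_mem_weylGroup (simpleRoot_mem (Nat.one_le_iff_ne_zero.mpr hi) i.is_le)⟩
  else 1

/-- The simple affine roots `α_0 = δ - θ, α_1, …, α_n`. A pair `(α, k)` stands for `α + k δ`, that
is, for the affine function `x ↦ (α, x) + k`. -/
def affineSimpleRoot {n : ℕ} (i : Fin (n + 1)) : V n × ℝ :=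
  if i.val = 0 then (-highestRoot n, 1) else (simpleRoot n i.val, 0)

/-- The action of the extended affine Weyl group on affine functions `f` by `g f = f ∘ g⁻¹`; thus
`t_p w (α + k δ) = w α + (k - (w α, p)) δ`. -/
def act {n : ℕ} (g : ExtAffineWeyl n) (f : V n × ℝ) : V n × ℝ :=
  (g.right.1 f.1, f.2 - dotProduct (g.right.1 f.1) (Multiplicative.toAdd g.left).1)

/-- The fundamental group `Λ ≅ P^∨ / Q^∨`, realized as the set of those elements of the extended
affine Weyl group that permute the simple affine roots. -/
def Lam (n : ℕ) : Set (ExtAffineWeyl n) :=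
  {g | act g '' Set.range affineSimpleRoot = Set.range affineSimpleRoot}

/-- The product `s_{i_1} ⋯ s_{i_r}` of a word `i_1 … i_r` in the labels `0, …, n`. -/
noncomputable def wordProd {n : ℕ} (L : List (Fin (n + 1))) : ExtAffineWeyl n := (L.map s).prod

/-- `g = lam s_{i_1} ⋯ s_{i_r}` is a reduced expression of `g`: `lam` lies in `Λ`, and `r` is the
least possible number of simple reflections among all the expressions of `g` of this form, i.e.
`r` is the length of `g`. -/
def IsReducedExpression {n : ℕ} (g lam : ExtAffineWeyl n) (L : List (Fin (n + 1))) : Prop :=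
  lam ∈ Lam n ∧ g = lam * wordProd L ∧
    ∀ lam' ∈ Lam n, ∀ L' : List (Fin (n + 1)), g = lam' * wordProd L' → L.length ≤ L'.length

/-- The element `π_n`, determined by the property that it maps `α_k` to `α_{n-k}`, `0 ≤ k ≤ n`. -/
def IsPi {n : ℕ} (g : ExtAffineWeyl n) : Prop :=
  ∀ k : Fin (n + 1), act g (affineSimpleRoot k) = affineSimpleRoot (Fin.rev k)

/-- The `i`-th fundamental coweight, `1 ≤ i ≤ n`, as a vector: `e_1 + ⋯ + e_i` for `i < n`, and
`(e_1 + ⋯ + e_n) / 2` for `i = n`. -/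
noncomputable def fundamentalCoweightVec (n i : ℕ) : V n :=
  if i < n then ∑ j ∈ Finset.Icc 1 i, e n j else (1 / 2 : ℝ) • ∑ j ∈ Finset.Icc 1 n, e n j

theorem sum_e_apply (n i : ℕ) (m : Fin n) :
    (∑ j ∈ Finset.Icc 1 i, e n j) m = if m.val + 1 ≤ i then 1 else 0 := by
  rw [Finset.sum_apply]
  simp only [e]
  rw [Finset.sum_ite_eq]
  simp

theorem fundamentalCoweightVec_mem (n i : ℕ) :
    fundamentalCoweightVec n i ∈ coweightLattice n := by
  apply mem_coweightLattice
  intro a b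
  unfold fundamentalCoweightVec
  split_ifs with h
  · rw [sum_e_apply, sum_e_apply]
    split_ifs
    · exact ⟨2, by norm_num⟩
    · exact ⟨1, by norm_num⟩
    · exact ⟨1, by norm_num⟩
    · exact ⟨0, by norm_num⟩
  · rw [Pi.smul_apply, Pi.smul_apply, sum_e_apply, sum_e_apply,
      if_pos (Nat.succ_le_of_lt a.isLt), if_pos (Nat.succ_le_of_lt b.isLt)]
    exact ⟨1, by norm_num⟩

/-- The defining property of the fundamental coweights. -/
theorem simpleRoot_dotProduct_fundamentalCoweightVec {n i j : ℕ} (hi' : i ≤ n)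
    (hj : 1 ≤ j) (hj' : j ≤ n) :
    dotProduct (simpleRoot n j) (fundamentalCoweightVec n i) = if i = j then 1 else 0 := by
  have h1 : j - 1 + 1 = j := by omega
  have h2 : n - 1 + 1 = n := by omega
  unfold simpleRoot fundamentalCoweightVec
  by_cases hjn : j < n
  · rw [if_pos hjn, sub_dotProduct, e_dotProduct hj hj', e_dotProduct (by omega) (by omega)]
    by_cases hin : i < n
    · rw [if_pos hin, sum_e_apply, sum_e_apply]
      simp only [h1, Nat.add_sub_cancel]
      split_ifs <;> first | omega | norm_num
    · rw [if_neg hin, Pi.smul_apply, Pi.smul_apply, sum_e_apply, sum_e_apply]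
      simp only [h1, Nat.add_sub_cancel]
      split_ifs <;> first | omega | norm_num
  · rw [if_neg hjn, smul_dotProduct, e_dotProduct (by omega) le_rfl]
    by_cases hin : i < n
    · rw [if_pos hin, sum_e_apply]
      simp only [h2]
      split_ifs <;> first | omega | norm_num
    · rw [if_neg hin, Pi.smul_apply, sum_e_apply]
      simp only [h2]
      split_ifs <;> first | omega | norm_num

/-- The element `ω_i` of the extended affine Weyl group: translation by the `i`-th fundamental
coweight. -/
noncomputable def ω {n : ℕ} (i : ℕ) : ExtAffineWeyl n :=
  translation ⟨fundamentalCoweightVec n i, fundamentalCoweightVec_mem n i⟩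

/-- The word `k, k+1, …, l` of `[k,l] = s_k s_{k+1} ⋯ s_l`, for `1 ≤ k ≤ l ≤ n`. (All the labels are
at most `n`, so that they are not changed by `Fin.ofNat (n + 1)`.) -/
def seg (n k l : ℕ) : List (Fin (n + 1)) :=
  (List.range' k (l + 1 - k)).map (Fin.ofNat (n + 1))

/-- The word of `s_n [n-1,n] ⋯ [2,n] [1,n]`. -/
def wordTop (n : ℕ) : List (Fin (n + 1)) :=
  (List.range n).flatMap fun j => seg n (n - j) n

/-- The word of `(s_0 [1,n])^i [n-i,n-1] ⋯ [2,i+1] [1,i]`. -/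
def wordMid (n i : ℕ) : List (Fin (n + 1)) :=
  (List.replicate i (0 :: seg n 1 n)).flatten ++
    (List.range (n - i)).flatMap fun j => seg n (n - i - j) (n - 1 - j)

end TypeC

/-!
The extended affine Weyl group acts faithfully on `ℝⁿ`, so the two product formulae are identities
between affine maps. The factor `s_0 [1,n]` is the affine rotation
`(x_1, …, x_n) ↦ (x_n + 1, x_1, …, x_{n-1})`; its `i`-th power adds `1` to the `i` coordinates that
it brings to the front, and `[n-i,n-1] ⋯ [1,i]` is the permutation which had moved them to the back.
The word `s_n [n-1,n] ⋯ [1,n]` reverses the coordinates and changes their signs, and `π_n` is the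
map `x_j ↦ 1/2 - x_{n+1-j}`: it is determined by its effect on the simple affine roots, because the
values of these at a point determine the point.

The expressions are reduced because of the length function which counts the affine root hyperplanes
between the fundamental alcove and its image. It vanishes on `Λ` and grows by at most one under
right multiplication by a simple reflection, since a simple reflection moves the alcove across a
single hyperplane; so it is a lower bound for the number of simple reflections in any expression.
For a translation by `p` it is the sum of `|(α, p)|` over the positive roots `α`, and for the
fundamental coweights this is the length of the given words.
-/

namespace TypeC

variable {n : ℕ}

section AffineAction

/-- The action of the extended affine Weyl group on `ℝⁿ` by affine transformations: `t_p w` acts as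
`x ↦ w x + p`. -/
instance affineAction : MulAction (ExtAffineWeyl n) (V n) where
  smul g x := g.right.1 x + g.left.toAdd.1
  one_smul x := add_zero x
  mul_smul g h x := by
    change g.right.1 (h.right.1 x) + (g.left.toAdd.1 + g.right.1 h.left.toAdd.1) =
      g.right.1 (h.right.1 x + h.left.toAdd.1) + g.left.toAdd.1
    rw [map_add]
    abel

theorem smul_def (g : ExtAffineWeyl n) (x : V n) : g • x = g.right.1 x + g.left.toAdd.1 := rfl

theorem translation_smul (p : coweightLattice n) (x : V n) : translation p • x = x + p.1 := rfl

theorem ω_smul (i : ℕ) (x : V n) : (ω i : ExtAffineWeyl n) • x = x + fundamentalCoweightVec n i :=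
  rfl

instance : FaithfulSMul (ExtAffineWeyl n) (V n) where
  eq_of_smul_eq_smul {g h} H := by
    have hleft : g.left.toAdd.1 = h.left.toAdd.1 := by simpa [smul_def] using H 0
    refine SemidirectProduct.ext (Subtype.ext hleft) (Subtype.ext (LinearEquiv.ext fun x => ?_))
    simpa [smul_def, hleft] using H x

theorem wordProd_nil_smul (x : V n) : wordProd ([] : List (Fin (n + 1))) • x = x :=
  one_smul _ x

theorem wordProd_cons (i : Fin (n + 1)) (L : List (Fin (n + 1))) :
    wordProd (i :: L) = s i * wordProd L := by
  simp only [wordProd, List.map_cons, List.prod_cons]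

theorem wordProd_append (L L' : List (Fin (n + 1))) :
    wordProd (L ++ L') = wordProd L * wordProd L' := by
  simp only [wordProd, List.map_append, List.prod_append]

end AffineAction

section Roots

theorem e_val_add_one (i : Fin n) : e n (i + 1) = Pi.single i 1 := by
  ext m
  simp [e, Pi.single_apply, Fin.ext_iff]

theorem reflection_single_sub_single {i j : Fin n} (hij : i ≠ j) (x : V n) :
    reflection (Pi.single i 1 - Pi.single j 1) x = x ∘ Equiv.swap i j := by
  have hnorm : ((Pi.single i 1 - Pi.single j 1 : V n)) ⬝ᵥ (Pi.single i 1 - Pi.single j 1) = 2 := by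
    simp only [dotProduct_sub, dotProduct_single, Pi.sub_apply, Pi.single_eq_same, ne_eq, hij,
      hij.symm, not_false_eq_true, Pi.single_eq_of_ne]
    norm_num
  ext m
  rw [reflection_apply, coroot, hnorm, Function.comp_apply, Equiv.swap_apply_def]
  rcases eq_or_ne m i with rfl | hi
  · simp [sub_dotProduct, hij]
  rcases eq_or_ne m j with rfl | hj
  · simp [sub_dotProduct, hij.symm]
  · simp [hi, hj]

theorem reflection_two_smul_single (i : Fin n) (x : V n) :
    reflection ((2 : ℝ) • Pi.single i 1) x = Function.update x i (-x i) := by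
  ext m
  rw [reflection_apply, coroot]
  rcases eq_or_ne m i with rfl | hi
  · simp only [smul_dotProduct, dotProduct_smul, single_one_dotProduct, Pi.sub_apply, Pi.smul_apply,
      Pi.single_eq_same, Function.update_self, smul_eq_mul]
    ring
  · simp [hi]

theorem dotProduct_reflection_reflection (α x y : V n) :
    reflection α x ⬝ᵥ reflection α y = x ⬝ᵥ y := by
  by_cases hα : α ⬝ᵥ α = 0
  · simp [reflection_apply, coroot, hα]
  · simp only [reflection_apply, coroot, sub_dotProduct, dotProduct_sub, smul_dotProduct,
      dotProduct_smul, smul_eq_mul, dotProduct_comm x α]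
    field_simp
    ring

theorem weylGroup_induction {P : (V n ≃ₗ[ℝ] V n) → Prop}
    (reflection : ∀ α ∈ roots n, P (reflection α)) (one : P 1)
    (mul : ∀ v w, P v → P w → P (v * w)) {w : V n ≃ₗ[ℝ] V n} (hw : w ∈ weylGroup n) : P w := by
  refine Subgroup.closure_induction'' (p := fun w _ => P w) ?_ ?_ one
    (fun v w _ _ => mul v w) hw
  · rintro _ ⟨α, hα, rfl⟩
    exact reflection α hα
  · rintro _ ⟨α, hα, rfl⟩
    exact reflection α hα

theorem dotProduct_weylGroup_apply {w : V n ≃ₗ[ℝ] V n} (hw : w ∈ weylGroup n) (x y : V n) :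
    w x ⬝ᵥ w y = x ⬝ᵥ y := by
  revert x y
  refine weylGroup_induction (P := fun w => ∀ x y, w x ⬝ᵥ w y = x ⬝ᵥ y)
    (fun α _ => dotProduct_reflection_reflection α) (fun _ _ => rfl) ?_ hw
  intro v w hv hw x y
  rw [LinearEquiv.mul_apply, LinearEquiv.mul_apply, hv, hw]

/-- The vectors `± e_i`. The roots are the nonzero sums of two of them, which reduces the invariance
of the root system under its Weyl group to that of this set. -/
def signedBasis (n : ℕ) : Set (V n) := {u | ∃ i, u = Pi.single i 1 ∨ u = -Pi.single i 1}

theorem single_mem_signedBasis (i : Fin n) : Pi.single i 1 ∈ signedBasis n := ⟨i, Or.inl rfl⟩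

theorem neg_mem_signedBasis {u : V n} (hu : u ∈ signedBasis n) : -u ∈ signedBasis n := by
  obtain ⟨i, rfl | rfl⟩ := hu
  · exact ⟨i, Or.inr rfl⟩
  · exact ⟨i, Or.inl (neg_neg _)⟩

theorem dotProduct_self_of_mem_signedBasis {u : V n} (hu : u ∈ signedBasis n) : u ⬝ᵥ u = 1 := by
  obtain ⟨i, rfl | rfl⟩ := hu <;> simp

theorem eq_or_eq_neg_or_dotProduct_eq_zero {u v : V n} (hu : u ∈ signedBasis n)
    (hv : v ∈ signedBasis n) : u = v ∨ u = -v ∨ u ⬝ᵥ v = 0 := by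
  obtain ⟨i, hi⟩ := hu
  obtain ⟨j, hj⟩ := hv
  rcases eq_or_ne i j with rfl | hij
  · rcases hi with rfl | rfl <;> rcases hj with rfl | rfl <;> simp
  · rcases hi with rfl | rfl <;> rcases hj with rfl | rfl <;> simp [hij]

theorem reflection_add_self_apply_mem_signedBasis {u z : V n} (hu : u ∈ signedBasis n)
    (hz : z ∈ signedBasis n) : reflection (u + u) z ∈ signedBasis n := by
  have huu := dotProduct_self_of_mem_signedBasis hu
  have hrefl : reflection (u + u) z = z - (2 * u ⬝ᵥ z) • u := by
    rw [reflection_apply, coroot]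
    simp only [add_dotProduct, dotProduct_add, huu]
    module
  rw [hrefl]
  rcases eq_or_eq_neg_or_dotProduct_eq_zero hz hu with rfl | rfl | hzu
  · convert neg_mem_signedBasis hu using 1
    rw [huu]
    module
  · convert hu using 1
    rw [dotProduct_neg, huu]
    module
  · rwa [dotProduct_comm, hzu, mul_zero, zero_smul, sub_zero]

theorem reflection_add_apply_mem_signedBasis_of_dotProduct_eq_zero {u v z : V n}
    (hu : u ∈ signedBasis n) (hv : v ∈ signedBasis n) (hz : z ∈ signedBasis n)
    (huv : u ⬝ᵥ v = 0) : reflection (u + v) z ∈ signedBasis n := by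
  have huu := dotProduct_self_of_mem_signedBasis hu
  have hvv := dotProduct_self_of_mem_signedBasis hv
  have hvu : v ⬝ᵥ u = 0 := by rwa [dotProduct_comm]
  have hrefl : reflection (u + v) z = z - (u ⬝ᵥ z + v ⬝ᵥ z) • (u + v) := by
    rw [reflection_apply, coroot]
    simp only [add_dotProduct, dotProduct_add, huu, hvv, huv, hvu]
    module
  rw [hrefl]
  rcases eq_or_eq_neg_or_dotProduct_eq_zero hz hu with rfl | rfl | hzu
  · convert neg_mem_signedBasis hv using 1
    rw [huu, hvu]
    module
  · convert hv using 1
    rw [dotProduct_neg, dotProduct_neg, huu, hvu]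
    module
  rcases eq_or_eq_neg_or_dotProduct_eq_zero hz hv with rfl | rfl | hzv
  · convert neg_mem_signedBasis hu using 1
    rw [hvv, huv]
    module
  · convert hu using 1
    rw [dotProduct_neg, dotProduct_neg, hvv, huv]
    module
  · rwa [dotProduct_comm u, dotProduct_comm v, hzu, hzv, add_zero, zero_smul, sub_zero]

theorem reflection_add_apply_mem_signedBasis {u v z : V n} (hu : u ∈ signedBasis n)
    (hv : v ∈ signedBasis n) (hz : z ∈ signedBasis n) : reflection (u + v) z ∈ signedBasis n := by
  rcases eq_or_eq_neg_or_dotProduct_eq_zero hu hv with rfl | rfl | huv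
  · exact reflection_add_self_apply_mem_signedBasis hu hz
  · simpa [reflection_apply] using hz
  · exact reflection_add_apply_mem_signedBasis_of_dotProduct_eq_zero hu hv hz huv

/-- The positive roots, labelled by all pairs `(a, b)`: the root labelled `(a, b)` is `e_a - e_b` if
`a < b` and `e_a + e_b` if `b ≤ a`. -/
def positiveRoot (q : Fin n × Fin n) : V n :=
  if q.1 < q.2 then Pi.single q.1 1 - Pi.single q.2 1 else Pi.single q.1 1 + Pi.single q.2 1

theorem positiveRoot_dotProduct (a b : Fin n) (x : V n) :
    positiveRoot (a, b) ⬝ᵥ x = if a < b then x a - x b else x a + x b := by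
  unfold positiveRoot
  split_ifs <;> simp [sub_dotProduct, add_dotProduct]

theorem positiveRoot_injective : Function.Injective (positiveRoot (n := n)) := by
  rintro ⟨a, b⟩ ⟨c, d⟩ h
  have apply_eq (i : Fin n) := congrArg (· ⬝ᵥ Pi.single i (1 : ℝ)) h
  simp only [positiveRoot_dotProduct, Pi.single_apply] at apply_eq
  have ha := apply_eq a
  have hb := apply_eq b
  have hc := apply_eq c
  grind

theorem positiveRoot_ne_zero (q : Fin n × Fin n) : positiveRoot q ≠ 0 := by
  intro h
  have := positiveRoot_dotProduct q.1 q.2 (Pi.single q.1 1)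
  rw [Prod.mk.eta, h, zero_dotProduct] at this
  simp only [Pi.single_apply] at this
  grind

theorem mem_roots_iff_positiveRoot {α : V n} :
    α ∈ roots n ↔ ∃ q, α = positiveRoot q ∨ α = -positiveRoot q := by
  constructor
  · rintro (⟨i, j, hi, hin, hj, hjn, hij, h⟩ | ⟨i, hi, hin, h⟩)
    · obtain ⟨a, rfl⟩ : ∃ a : Fin n, i = a + 1 := ⟨⟨i - 1, by omega⟩, (Nat.sub_add_cancel hi).symm⟩
      obtain ⟨b, rfl⟩ : ∃ b : Fin n, j = b + 1 := ⟨⟨j - 1, by omega⟩, (Nat.sub_add_cancel hj).symm⟩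
      have hab : a ≠ b := fun h => hij (by rw [h])
      simp only [e_val_add_one] at h
      rcases hab.lt_or_gt with hlt | hlt
      · rcases h with rfl | rfl | rfl
        · exact ⟨(a, b), Or.inl (by simp [positiveRoot, hlt])⟩
        · exact ⟨(b, a), Or.inl (by simp [positiveRoot, hlt.not_gt, add_comm])⟩
        · exact ⟨(b, a), Or.inr (by simp [positiveRoot, hlt.not_gt, add_comm])⟩
      · rcases h with rfl | rfl | rfl
        · exact ⟨(b, a), Or.inr (by simp [positiveRoot, hlt])⟩
        · exact ⟨(a, b), Or.inl (by simp [positiveRoot, hlt.not_gt])⟩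
        · exact ⟨(a, b), Or.inr (by simp [positiveRoot, hlt.not_gt])⟩
    · obtain ⟨a, rfl⟩ : ∃ a : Fin n, i = a + 1 := ⟨⟨i - 1, by omega⟩, (Nat.sub_add_cancel hi).symm⟩
      refine ⟨(a, a), ?_⟩
      simpa only [positiveRoot, lt_irrefl, if_false, e_val_add_one, ← two_smul ℝ] using h
  · rintro ⟨⟨a, b⟩, h⟩
    simp only [positiveRoot, ← e_val_add_one] at h
    split_ifs at h with hab
    · have hne : (a : ℕ) + 1 ≠ b + 1 := by omega
      rcases h with rfl | rfl
      · exact Or.inl ⟨a + 1, b + 1, by omega, a.2, by omega, b.2, hne, Or.inl rfl⟩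
      · exact Or.inl ⟨b + 1, a + 1, by omega, b.2, by omega, a.2, hne.symm,
          Or.inl (neg_sub _ _)⟩
    · rcases eq_or_ne a b with rfl | hne
      · exact Or.inr ⟨a + 1, by omega, a.2, by rwa [two_smul]⟩
      · exact Or.inl ⟨a + 1, b + 1, by omega, a.2, by omega, b.2, by simpa [Fin.ext_iff] using hne,
          Or.inr h⟩

theorem positiveRoot_mem_roots (q : Fin n × Fin n) : positiveRoot q ∈ roots n :=
  mem_roots_iff_positiveRoot.mpr ⟨q, Or.inl rfl⟩

theorem exists_add_eq_of_mem_roots {α : V n} (hα : α ∈ roots n) :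
    ∃ u ∈ signedBasis n, ∃ v ∈ signedBasis n, u + v ≠ 0 ∧ u + v = α := by
  obtain ⟨⟨a, b⟩, h⟩ := mem_roots_iff_positiveRoot.mp hα
  have ha := single_mem_signedBasis a
  have hb := single_mem_signedBasis b
  have hne := positiveRoot_ne_zero (a, b)
  unfold positiveRoot at h hne
  split_ifs at h hne with hab
  · rcases h with rfl | rfl
    · exact ⟨_, ha, _, neg_mem_signedBasis hb, by rwa [← sub_eq_add_neg], by abel⟩
    · exact ⟨_, hb, _, neg_mem_signedBasis ha, by rwa [← sub_eq_add_neg, ← neg_sub, neg_ne_zero],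
        by abel⟩
  · rcases h with rfl | rfl
    · exact ⟨_, ha, _, hb, hne, rfl⟩
    · exact ⟨_, neg_mem_signedBasis ha, _, neg_mem_signedBasis hb,
        by rwa [← neg_add, neg_ne_zero], by abel⟩

theorem add_mem_roots {u v : V n} (hu : u ∈ signedBasis n) (hv : v ∈ signedBasis n)
    (hne : u + v ≠ 0) : u + v ∈ roots n := by
  rw [mem_roots_iff_positiveRoot]
  obtain ⟨a, hu⟩ := hu
  obtain ⟨b, hv⟩ := hv
  rcases lt_trichotomy a b with hab | rfl | hab
  · rcases hu with rfl | rfl <;> rcases hv with rfl | rfl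
    · exact ⟨(b, a), Or.inl (by simp [positiveRoot, hab.not_gt, add_comm])⟩
    · exact ⟨(a, b), Or.inl (by simp [positiveRoot, hab, sub_eq_add_neg])⟩
    · exact ⟨(a, b), Or.inr (by simp [positiveRoot, hab, add_comm, sub_eq_add_neg])⟩
    · exact ⟨(b, a), Or.inr (by simp [positiveRoot, hab.not_gt])⟩
  · rcases hu with rfl | rfl <;> rcases hv with rfl | rfl
    · exact ⟨(a, a), Or.inl (by simp [positiveRoot])⟩
    · simp at hne
    · simp at hne
    · exact ⟨(a, a), Or.inr (by simp [positiveRoot])⟩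
  · rcases hu with rfl | rfl <;> rcases hv with rfl | rfl
    · exact ⟨(a, b), Or.inl (by simp [positiveRoot, hab.not_gt])⟩
    · exact ⟨(b, a), Or.inr (by simp [positiveRoot, hab, sub_eq_add_neg])⟩
    · exact ⟨(b, a), Or.inl (by simp [positiveRoot, hab, add_comm, sub_eq_add_neg])⟩
    · exact ⟨(a, b), Or.inr (by simp [positiveRoot, hab.not_gt, add_comm])⟩

theorem weylGroup_apply_mem_roots {w : V n ≃ₗ[ℝ] V n} (hw : w ∈ weylGroup n) {α : V n}
    (hα : α ∈ roots n) : w α ∈ roots n := by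
  have mem_signedBasis : ∀ z ∈ signedBasis n, w z ∈ signedBasis n := by
    refine weylGroup_induction (P := fun w => ∀ z ∈ signedBasis n, w z ∈ signedBasis n) ?_
      (fun _ hz => hz) (fun v w hv hw z hz => hv _ (hw z hz)) hw
    intro β hβ z hz
    obtain ⟨u, hu, v, hv, -, rfl⟩ := exists_add_eq_of_mem_roots hβ
    exact reflection_add_apply_mem_signedBasis hu hv hz
  obtain ⟨u, hu, v, hv, hne, rfl⟩ := exists_add_eq_of_mem_roots hα
  rw [map_add]
  exact add_mem_roots (mem_signedBasis u hu) (mem_signedBasis v hv)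
    (by rwa [← map_add, w.map_ne_zero_iff])

end Roots

section AffineFunctions

@[elab_as_elim]
theorem label_induction {P : Fin (n + 2) → Prop} (zero : P 0)
    (castSucc_succ : ∀ k : Fin n, P k.castSucc.succ) (last : P (Fin.last (n + 1))) (i) : P i :=
  Fin.cases zero (Fin.lastCases last castSucc_succ) i

/-- The value at `x` of the affine function `α + k δ`, encoded as the pair `(α, k)`. -/
def evalAffine (f : V n × ℝ) (x : V n) : ℝ := f.1 ⬝ᵥ x + f.2

theorem evalAffine_act_smul (g : ExtAffineWeyl n) (f : V n × ℝ) (x : V n) :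
    evalAffine (act g f) (g • x) = evalAffine f x := by
  simp only [evalAffine, act, smul_def, dotProduct_add, dotProduct_weylGroup_apply g.right.2]
  ring

theorem evalAffine_injective : Function.Injective (evalAffine (n := n)) := by
  intro f f' h
  have hconst : f.2 = f'.2 := by simpa [evalAffine] using congrFun h 0
  refine Prod.ext (dotProduct_eq _ _ fun x => ?_) hconst
  simpa [evalAffine, hconst] using congrFun h x

theorem act_eq_iff {g : ExtAffineWeyl n} {f f' : V n × ℝ} :
    act g f = f' ↔ ∀ x, evalAffine f' (g • x) = evalAffine f x := by
  refine ⟨fun h x => by rw [← h, evalAffine_act_smul], fun h => evalAffine_injective ?_⟩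
  ext x
  rw [← smul_inv_smul g x, evalAffine_act_smul, h]

theorem simpleRoot_val_add_one (k : Fin n) :
    simpleRoot (n + 1) (k + 1) = Pi.single k.castSucc 1 - Pi.single k.succ 1 := by
  rw [simpleRoot, if_pos (by omega), ← e_val_add_one, ← e_val_add_one, Fin.val_castSucc,
    Fin.val_succ]

theorem simpleRoot_self : simpleRoot (n + 1) (n + 1) = (2 : ℝ) • Pi.single (Fin.last n) 1 := by
  rw [simpleRoot, if_neg (lt_irrefl _), ← e_val_add_one, Fin.val_last]

theorem highestRoot_eq_two_smul_single :
    highestRoot (n + 1) = (2 : ℝ) • Pi.single 0 1 := by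
  rw [highestRoot, ← e_val_add_one, Fin.val_zero]

theorem evalAffine_affineSimpleRoot_zero (x : V (n + 1)) :
    evalAffine (affineSimpleRoot 0) x = 1 - 2 * x 0 := by
  rw [evalAffine, affineSimpleRoot, if_pos (Fin.val_zero _), highestRoot_eq_two_smul_single]
  simp only [neg_dotProduct, smul_dotProduct, single_one_dotProduct, smul_eq_mul]
  ring

theorem evalAffine_affineSimpleRoot_castSucc_succ (k : Fin n) (x : V (n + 1)) :
    evalAffine (affineSimpleRoot k.castSucc.succ) x = x k.castSucc - x k.succ := by
  rw [evalAffine, affineSimpleRoot, if_neg (by simp), Fin.val_succ, Fin.val_castSucc,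
    simpleRoot_val_add_one]
  simp only [sub_dotProduct, single_one_dotProduct, add_zero]

theorem evalAffine_affineSimpleRoot_last (x : V (n + 1)) :
    evalAffine (affineSimpleRoot (Fin.last (n + 1))) x = 2 * x (Fin.last n) := by
  rw [evalAffine, affineSimpleRoot, if_neg (by simp), Fin.val_last, simpleRoot_self]
  simp only [smul_dotProduct, single_one_dotProduct, smul_eq_mul, add_zero]

theorem eq_of_evalAffine_affineSimpleRoot {x y : V (n + 1)}
    (h : ∀ k, evalAffine (affineSimpleRoot k) x = evalAffine (affineSimpleRoot k) y) : x = y := by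
  ext j
  induction j using Fin.reverseInduction with
  | last =>
    have hlast := h (Fin.last (n + 1))
    rw [evalAffine_affineSimpleRoot_last, evalAffine_affineSimpleRoot_last] at hlast
    exact mul_left_cancel₀ two_ne_zero hlast
  | cast j ih =>
    have hj := h j.castSucc.succ
    rwa [evalAffine_affineSimpleRoot_castSucc_succ, evalAffine_affineSimpleRoot_castSucc_succ, ih,
      sub_left_inj] at hj

end AffineFunctions

section SimpleReflections

theorem s_zero_smul (x : V (n + 1)) : s (0 : Fin (n + 2)) • x = Function.update x 0 (1 - x 0) := by
  rw [s, dif_pos (by omega), dif_pos (Fin.val_zero _), mul_smul, translation_smul]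
  change reflection (highestRoot (n + 1)) x + 0 + coroot (highestRoot (n + 1)) = _
  rw [highestRoot_eq_two_smul_single, add_zero, reflection_two_smul_single]
  ext m
  rcases eq_or_ne m 0 with rfl | hm
  · simp only [coroot, smul_dotProduct, dotProduct_smul, single_one_dotProduct, Pi.add_apply,
      Pi.smul_apply, Pi.single_eq_same, Function.update_self, smul_eq_mul]
    ring
  · simp [coroot, hm]

theorem s_smul_of_ne_zero {i : Fin (n + 1)} (hi : i ≠ 0) (x : V n) :
    s i • x = reflection (simpleRoot n i) x := by
  have hi : i.val ≠ 0 := by rwa [ne_eq, Fin.val_eq_zero_iff]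
  rw [s, dif_pos (by omega), dif_neg hi]
  exact add_zero _

theorem s_castSucc_succ_smul (k : Fin n) (x : V (n + 1)) :
    s k.castSucc.succ • x = x ∘ Equiv.swap k.castSucc k.succ := by
  rw [s_smul_of_ne_zero (Fin.succ_ne_zero _), Fin.val_succ, Fin.val_castSucc,
    simpleRoot_val_add_one, reflection_single_sub_single (Fin.castSucc_lt_succ).ne]

theorem s_last_smul (x : V (n + 1)) :
    s (Fin.last (n + 1)) • x = Function.update x (Fin.last n) (-x (Fin.last n)) := by
  rw [s_smul_of_ne_zero (Fin.last_pos.ne'), Fin.val_last, simpleRoot_self,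
    reflection_two_smul_single]

end SimpleReflections

section Alcove

/-- The fundamental alcove, on which all simple affine roots are positive. -/
def alcove (n : ℕ) : Set (V n) := {x | ∀ k, 0 < evalAffine (affineSimpleRoot k) x}

theorem mem_alcove_iff {x : V (n + 1)} :
    x ∈ alcove (n + 1) ↔ x 0 < 1 / 2 ∧ StrictAnti x ∧ 0 < x (Fin.last n) := by
  rw [Fin.strictAnti_iff_succ_lt]
  constructor
  · intro hx
    have hzero := hx 0
    have hlast := hx (Fin.last _)
    rw [evalAffine_affineSimpleRoot_zero] at hzero
    rw [evalAffine_affineSimpleRoot_last] at hlast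
    refine ⟨by linarith, fun k => ?_, by linarith⟩
    have hk := hx k.castSucc.succ
    rwa [evalAffine_affineSimpleRoot_castSucc_succ, sub_pos] at hk
  · rintro ⟨hzero, hanti, hlast⟩ k
    induction k using label_induction with
    | zero =>
      rw [evalAffine_affineSimpleRoot_zero]
      linarith
    | castSucc_succ k =>
      rw [evalAffine_affineSimpleRoot_castSucc_succ, sub_pos]
      exact hanti k
    | last =>
      rw [evalAffine_affineSimpleRoot_last]
      linarith

theorem smul_mem_alcove {g : ExtAffineWeyl n} (hg : g ∈ Lam n) {x : V n} (hx : x ∈ alcove n) :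
    g • x ∈ alcove n := by
  intro k
  obtain ⟨_, ⟨j, rfl⟩, hj⟩ : affineSimpleRoot k ∈ act g '' Set.range affineSimpleRoot := by
    rw [show act g '' _ = _ from hg]
    exact ⟨k, rfl⟩
  rw [← hj, evalAffine_act_smul]
  exact hx j

theorem apply_mem_Ioo_of_mem_alcove {x : V n} (hx : x ∈ alcove n) (j : Fin n) :
    x j ∈ Set.Ioo 0 (1 / 2) := by
  obtain ⟨m, rfl⟩ : ∃ m, n = m + 1 := ⟨n - 1, by have := j.pos; omega⟩
  obtain ⟨hzero, hanti, hlast⟩ := mem_alcove_iff.mp hx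
  exact ⟨hlast.trans_le (hanti.antitone (Fin.le_last j)),
    (hanti.antitone (Fin.zero_le j)).trans_lt hzero⟩

theorem positiveRoot_dotProduct_mem_Ioo {x : V n} (hx : x ∈ alcove n) (q : Fin n × Fin n) :
    positiveRoot q ⬝ᵥ x ∈ Set.Ioo 0 1 := by
  obtain ⟨a, b⟩ := q
  obtain ⟨ha0, ha1⟩ := apply_mem_Ioo_of_mem_alcove hx a
  obtain ⟨hb0, hb1⟩ := apply_mem_Ioo_of_mem_alcove hx b
  rw [positiveRoot_dotProduct]
  split_ifs with hab
  · obtain ⟨m, rfl⟩ : ∃ m, n = m + 1 := ⟨n - 1, by have := a.pos; omega⟩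
    have := (mem_alcove_iff.mp hx).2.1 hab
    constructor <;> linarith
  · constructor <;> linarith

/-- A point of the fundamental alcove, proportional to the half sum of the positive roots. The
length is read off from the image of this point. -/
noncomputable def alcovePoint (n : ℕ) : V n := fun j => (n - j) / (2 * n + 1)

theorem alcovePoint_mem_alcove (n : ℕ) : alcovePoint (n + 1) ∈ alcove (n + 1) := by
  rw [mem_alcove_iff]
  refine ⟨?_, fun i j hij => ?_, ?_⟩
  · simp only [alcovePoint]
    rw [div_lt_iff₀ (by positivity)]
    push_cast
    rw [Fin.val_zero, Nat.cast_zero]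
    linarith
  · have : (i : ℝ) < j := by exact_mod_cast hij
    simp only [alcovePoint]
    gcongr
  · simp only [alcovePoint, Fin.val_last]
    push_cast
    rw [add_sub_cancel_left]
    positivity

end Alcove

section Length

theorem eq_of_positiveRoot_eq_or_eq_neg {q q' : Fin n × Fin n}
    (h : positiveRoot q = positiveRoot q' ∨ positiveRoot q = -positiveRoot q') : q = q' := by
  refine h.elim (fun h => positiveRoot_injective h) fun h => ?_
  obtain ⟨m, rfl⟩ : ∃ m, n = m + 1 := ⟨n - 1, by have := q.1.pos; omega⟩
  have hq := positiveRoot_dotProduct_mem_Ioo (alcovePoint_mem_alcove m) q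
  have hq' := positiveRoot_dotProduct_mem_Ioo (alcovePoint_mem_alcove m) q'
  rw [h, neg_dotProduct] at hq
  linarith [hq.1, hq'.1]

theorem exists_perm_weylGroup_apply_positiveRoot {w : V n ≃ₗ[ℝ] V n} (hw : w ∈ weylGroup n) :
    ∃ σ : Equiv.Perm (Fin n × Fin n), ∀ q,
      w (positiveRoot q) = positiveRoot (σ q) ∨ w (positiveRoot q) = -positiveRoot (σ q) := by
  choose σ hσ using fun q => mem_roots_iff_positiveRoot.mp
    (weylGroup_apply_mem_roots hw (positiveRoot_mem_roots q))
  have hinj : Function.Injective σ := by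
    intro q q' hqq'
    refine eq_of_positiveRoot_eq_or_eq_neg ?_
    rw [← w.injective.eq_iff, ← w.injective.eq_iff (b := -_), map_neg]
    rcases hσ q with h | h <;> rcases hσ q' with h' | h' <;> simp [h, h', hqq']
  exact ⟨Equiv.ofBijective σ (Finite.injective_iff_bijective.mp hinj), hσ⟩

theorem positiveRoot_dotProduct_s_zero_smul_mem_Ioo {x : V (n + 1)} (hx : x ∈ alcove (n + 1))
    {q : Fin (n + 1) × Fin (n + 1)} (hq : q ≠ (0, 0)) :
    positiveRoot q ⬝ᵥ (s (0 : Fin (n + 2)) • x) ∈ Set.Ioo 0 1 := by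
  obtain ⟨a, b⟩ := q
  obtain ⟨ha0, ha1⟩ := apply_mem_Ioo_of_mem_alcove hx a
  obtain ⟨hb0, hb1⟩ := apply_mem_Ioo_of_mem_alcove hx b
  have hroot := positiveRoot_dotProduct_mem_Ioo hx (a, b)
  have hanti := (mem_alcove_iff.mp hx).2.1
  rw [positiveRoot_dotProduct] at hroot
  rw [s_zero_smul, positiveRoot_dotProduct, Function.update_apply, Function.update_apply]
  rcases eq_or_ne a 0 with rfl | ha
  · have hb : b ≠ 0 := by rintro rfl; exact hq rfl
    have hb' : 0 < b := Fin.pos_iff_ne_zero.mpr hb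
    simp only [if_pos, if_neg hb, hb']
    constructor <;> linarith
  rcases eq_or_ne b 0 with rfl | hb
  · have ha' : 0 < a := Fin.pos_iff_ne_zero.mpr ha
    have := hanti ha'
    simp only [if_pos, if_neg ha, Fin.not_lt_zero, if_false]
    constructor <;> linarith
  · simpa only [if_neg ha, if_neg hb] using hroot

theorem positiveRoot_dotProduct_s_castSucc_succ_smul_mem_Ioo {x : V (n + 1)}
    (hx : x ∈ alcove (n + 1)) {k : Fin n} {q : Fin (n + 1) × Fin (n + 1)}
    (hq : q ≠ (k.castSucc, k.succ)) :
    positiveRoot q ⬝ᵥ (s k.castSucc.succ • x) ∈ Set.Ioo 0 1 := by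
  obtain ⟨a, b⟩ := q
  rw [s_castSucc_succ_smul, positiveRoot_dotProduct, Function.comp_apply, Function.comp_apply]
  obtain ⟨ha0, ha1⟩ := apply_mem_Ioo_of_mem_alcove hx (Equiv.swap k.castSucc k.succ a)
  obtain ⟨hb0, hb1⟩ := apply_mem_Ioo_of_mem_alcove hx (Equiv.swap k.castSucc k.succ b)
  split_ifs with hab
  · have hswap : Equiv.swap k.castSucc k.succ a < Equiv.swap k.castSucc k.succ b := by
      simp only [Equiv.swap_apply_def, ne_eq, Prod.mk.injEq, Fin.ext_iff, Fin.lt_def,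
        apply_ite Fin.val, Fin.val_castSucc, Fin.val_succ] at hq hab ⊢
      split_ifs <;> omega
    have := (mem_alcove_iff.mp hx).2.1 hswap
    constructor <;> linarith
  · constructor <;> linarith

theorem positiveRoot_dotProduct_s_last_smul_mem_Ioo {x : V (n + 1)} (hx : x ∈ alcove (n + 1))
    {q : Fin (n + 1) × Fin (n + 1)} (hq : q ≠ (Fin.last n, Fin.last n)) :
    positiveRoot q ⬝ᵥ (s (Fin.last (n + 1)) • x) ∈ Set.Ioo 0 1 := by
  obtain ⟨a, b⟩ := q
  obtain ⟨ha0, ha1⟩ := apply_mem_Ioo_of_mem_alcove hx a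
  obtain ⟨hb0, hb1⟩ := apply_mem_Ioo_of_mem_alcove hx b
  have hroot := positiveRoot_dotProduct_mem_Ioo hx (a, b)
  have hanti := (mem_alcove_iff.mp hx).2.1
  rw [positiveRoot_dotProduct] at hroot
  rw [s_last_smul, positiveRoot_dotProduct, Function.update_apply, Function.update_apply]
  rcases eq_or_ne b (Fin.last n) with rfl | hb
  · have ha : a ≠ Fin.last n := by rintro rfl; exact hq rfl
    have ha' : a < Fin.last n := Fin.lt_last_iff_ne_last.mpr ha
    simp only [if_pos, if_neg ha, ha']
    constructor <;> linarith
  rcases eq_or_ne a (Fin.last n) with rfl | ha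
  · have hb' : b < Fin.last n := Fin.lt_last_iff_ne_last.mpr hb
    have := hanti hb'
    simp only [if_pos, if_neg hb, hb'.not_gt, if_false]
    constructor <;> linarith
  · simpa only [if_neg ha, if_neg hb] using hroot

theorem exists_positiveRoot_dotProduct_s_smul_mem (i : Fin (n + 2)) :
    ∃ q₀, ∀ x ∈ alcove (n + 1),
      positiveRoot q₀ ⬝ᵥ (s i • x) ∈ Set.Ioo (-1) 0 ∪ Set.Ioo 1 2 ∧
        ∀ q ≠ q₀, positiveRoot q ⬝ᵥ (s i • x) ∈ Set.Ioo 0 1 := by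
  induction i using label_induction with
  | zero =>
    refine ⟨(0, 0), fun x hx => ⟨Or.inr ?_, fun q hq =>
      positiveRoot_dotProduct_s_zero_smul_mem_Ioo hx hq⟩⟩
    obtain ⟨h0, h1⟩ := apply_mem_Ioo_of_mem_alcove hx 0
    rw [s_zero_smul, positiveRoot_dotProduct, if_neg (lt_irrefl _), Function.update_self]
    constructor <;> linarith
  | castSucc_succ k =>
    refine ⟨(k.castSucc, k.succ), fun x hx => ⟨Or.inl ?_, fun q hq =>
      positiveRoot_dotProduct_s_castSucc_succ_smul_mem_Ioo hx hq⟩⟩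
    obtain ⟨h0, h1⟩ := positiveRoot_dotProduct_mem_Ioo hx (k.castSucc, k.succ)
    rw [positiveRoot_dotProduct, if_pos Fin.castSucc_lt_succ] at h0 h1
    rw [s_castSucc_succ_smul, positiveRoot_dotProduct, if_pos Fin.castSucc_lt_succ,
      Function.comp_apply, Function.comp_apply, Equiv.swap_apply_left, Equiv.swap_apply_right]
    constructor <;> linarith
  | last =>
    refine ⟨(Fin.last n, Fin.last n), fun x hx => ⟨Or.inl ?_, fun q hq =>
      positiveRoot_dotProduct_s_last_smul_mem_Ioo hx hq⟩⟩
    obtain ⟨h0, h1⟩ := apply_mem_Ioo_of_mem_alcove hx (Fin.last n)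
    rw [s_last_smul, positiveRoot_dotProduct, if_neg (lt_irrefl _), Function.update_self]
    constructor <;> linarith

theorem exists_abs_floor_sub_floor_le (i : Fin (n + 2)) :
    ∃ q₀, ∀ x ∈ alcove (n + 1), ∀ q α, α = positiveRoot q ∨ α = -positiveRoot q →
      |⌊α ⬝ᵥ (s i • x)⌋ - ⌊α ⬝ᵥ x⌋| ≤ if q = q₀ then 1 else 0 := by
  obtain ⟨q₀, hq₀⟩ := exists_positiveRoot_dotProduct_s_smul_mem i
  have floor_eq {r : ℝ} (m : ℤ) (hr : r ∈ Set.Ioo (m : ℝ) (m + 1)) : ⌊r⌋ = m ∧ ⌊-r⌋ = -m - 1 := by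
    refine ⟨Int.floor_eq_iff.mpr ⟨hr.1.le, hr.2⟩, Int.floor_eq_iff.mpr ?_⟩
    push_cast
    constructor <;> linarith [hr.1, hr.2]
  refine ⟨q₀, fun x hx q α hα => ?_⟩
  obtain ⟨hfloor, hfloor_neg⟩ := floor_eq 0 (by simpa using positiveRoot_dotProduct_mem_Ioo hx q)
  obtain ⟨hcross, hstay⟩ := hq₀ x hx
  obtain ⟨m, hm, hroot⟩ : ∃ m : ℤ, |m| ≤ (if q = q₀ then 1 else 0) ∧
      positiveRoot q ⬝ᵥ (s i • x) ∈ Set.Ioo (m : ℝ) (m + 1) := by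
    split_ifs with hq
    · subst hq
      rcases hcross with h | h
      · exact ⟨-1, by simp, by simpa using h⟩
      · exact ⟨1, by simp, by rwa [Int.cast_one, one_add_one_eq_two]⟩
    · exact ⟨0, by simp, by simpa using hstay q hq⟩
  obtain ⟨hfloor', hfloor_neg'⟩ := floor_eq m hroot
  rcases hα with rfl | rfl
  · simpa [hfloor, hfloor'] using hm
  · simpa [neg_dotProduct, hfloor_neg, hfloor_neg', abs_neg] using hm

theorem exists_int_dotProduct_smul_eq (g : ExtAffineWeyl n) {α : V n} (hα : α ∈ roots n) :
    ∃ m : ℤ, ∀ x, α ⬝ᵥ (g • x) = (g.right⁻¹.1 α) ⬝ᵥ x + m := by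
  obtain ⟨m, hm⟩ := g.left.toAdd.2 α hα
  refine ⟨m, fun x => ?_⟩
  rw [smul_def, dotProduct_add, hm, ← dotProduct_weylGroup_apply g.right⁻¹.2 α]
  congr 2
  exact g.right.1.symm_apply_apply x

/-- The number of affine hyperplanes `(α, x) = m` separating the fundamental alcove from its image
under `g`: there are `|⌊(α, g x)⌋|` of them for each positive root `α` and any `x` in the alcove. -/
noncomputable def length (g : ExtAffineWeyl n) : ℕ :=
  ∑ q, ⌊positiveRoot q ⬝ᵥ (g • alcovePoint n)⌋.natAbs

theorem length_of_mem_Lam {g : ExtAffineWeyl (n + 1)} (hg : g ∈ Lam (n + 1)) : length g = 0 := by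
  refine Finset.sum_eq_zero fun q _ => ?_
  obtain ⟨h0, h1⟩ :=
    positiveRoot_dotProduct_mem_Ioo (smul_mem_alcove hg (alcovePoint_mem_alcove n)) q
  rw [Int.floor_eq_zero_iff.mpr ⟨h0.le, h1⟩, Int.natAbs_zero]

theorem length_mul_s_le (g : ExtAffineWeyl (n + 1)) (i : Fin (n + 2)) :
    length (g * s i) ≤ length g + 1 := by
  obtain ⟨σ, hσ⟩ := exists_perm_weylGroup_apply_positiveRoot g.right⁻¹.2
  obtain ⟨q₀, hq₀⟩ := exists_abs_floor_sub_floor_le i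
  have hterm (q : Fin (n + 1) × Fin (n + 1)) :
      ⌊positiveRoot q ⬝ᵥ ((g * s i) • alcovePoint (n + 1))⌋.natAbs ≤
        ⌊positiveRoot q ⬝ᵥ (g • alcovePoint (n + 1))⌋.natAbs + if σ q = q₀ then 1 else 0 := by
    obtain ⟨m, hm⟩ := exists_int_dotProduct_smul_eq g (positiveRoot_mem_roots q)
    have hfloor := hq₀ _ (alcovePoint_mem_alcove n) (σ q) _ (hσ q)
    rw [mul_smul, hm, hm, Int.floor_add_intCast, Int.floor_add_intCast]
    split_ifs at hfloor ⊢ <;> rw [abs_le] at hfloor <;> omega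
  calc length (g * s i)
    _ ≤ ∑ q, (⌊positiveRoot q ⬝ᵥ (g • alcovePoint (n + 1))⌋.natAbs +
          if σ q = q₀ then 1 else 0) := Finset.sum_le_sum fun q _ => hterm q
    _ = length g + 1 := by
      rw [Finset.sum_add_distrib, Equiv.sum_comp σ (fun q => if q = q₀ then 1 else 0),
        Finset.sum_ite_eq' Finset.univ, if_pos (Finset.mem_univ _), length]

theorem length_mul_wordProd_le (g : ExtAffineWeyl (n + 1)) (L : List (Fin (n + 2))) :
    length (g * wordProd L) ≤ length g + L.length := by
  induction L generalizing g with
  | nil => simp [wordProd]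
  | cons i L ih =>
    rw [wordProd_cons, ← mul_assoc, List.length_cons]
    linarith [ih (g * s i), length_mul_s_le g i]

theorem isReducedExpression_of_length_le {g lam : ExtAffineWeyl (n + 1)} {L : List (Fin (n + 2))}
    (hlam : lam ∈ Lam (n + 1)) (hg : g = lam * wordProd L) (hL : L.length ≤ length g) :
    IsReducedExpression g lam L := by
  refine ⟨hlam, hg, fun lam' hlam' L' hg' => ?_⟩
  calc L.length ≤ length (lam' * wordProd L') := hg' ▸ hL
    _ ≤ length lam' + L'.length := length_mul_wordProd_le lam' L'
    _ = L'.length := by rw [length_of_mem_Lam hlam', zero_add]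

theorem length_translation (p : coweightLattice (n + 1)) :
    (length (translation p) : ℝ) = ∑ q, |positiveRoot q ⬝ᵥ p.1| := by
  rw [length, Nat.cast_sum]
  refine Finset.sum_congr rfl fun q _ => ?_
  obtain ⟨m, hm⟩ := p.2 _ (positiveRoot_mem_roots q)
  obtain ⟨h0, h1⟩ := positiveRoot_dotProduct_mem_Ioo (alcovePoint_mem_alcove n) q
  rw [translation_smul, dotProduct_add, hm, Int.floor_add_intCast,
    Int.floor_eq_zero_iff.mpr ⟨h0.le, h1⟩, zero_add, Nat.cast_natAbs, Int.cast_abs]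

theorem sum_positiveRoot_dotProduct (x : V n) :
    ∑ q, positiveRoot q ⬝ᵥ x = ∑ b : Fin n, 2 * (n - b) * x b := by
  have hroot (a b : Fin n) :
      positiveRoot (a, b) ⬝ᵥ x = x a + (1 - 2 * if a < b then 1 else 0) * x b := by
    rw [positiveRoot_dotProduct]
    split_ifs <;> ring
  have hcard (b : Fin n) : ∑ a : Fin n, (if a < b then (1 : ℝ) else 0) = b := by
    rw [Finset.sum_boole, Finset.filter_gt_eq_Iio, Fin.card_Iio]
  have hcolumn (b : Fin n) :
      ∑ a : Fin n, (1 - 2 * if a < b then (1 : ℝ) else 0) * x b = (n - 2 * b) * x b := by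
    rw [← Finset.sum_mul, Finset.sum_sub_distrib, ← Finset.mul_sum, hcard]
    simp
  simp only [Fintype.sum_prod_type, hroot, Finset.sum_add_distrib]
  rw [Finset.sum_comm (f := fun a b : Fin n => (1 - 2 * if a < b then (1 : ℝ) else 0) * x b)]
  simp only [hcolumn, Finset.sum_const, Finset.card_univ, Fintype.card_fin, nsmul_eq_mul]
  rw [← Finset.sum_add_distrib]
  exact Finset.sum_congr rfl fun b _ => by ring

theorem sum_positiveRoot_dotProduct_ite {i : ℕ} (hi : i ≤ n) (c : ℝ) :
    ∑ q, positiveRoot q ⬝ᵥ (fun b : Fin n => if (b : ℕ) < i then c else 0) =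
      c * (i * (2 * n + 1 - i)) := by
  rw [sum_positiveRoot_dotProduct,
    Fin.sum_univ_eq_sum_range (fun b : ℕ => 2 * ((n : ℝ) - b) * if b < i then c else 0)]
  simp only [mul_ite, mul_zero]
  rw [← Finset.sum_filter]
  have hfilter : (Finset.range n).filter (· < i) = Finset.range i := by
    ext b
    rw [Finset.mem_filter, Finset.mem_range, Finset.mem_range]
    omega
  rw [hfilter]
  clear hfilter hi
  induction i with
  | zero => simp
  | succ i ih =>
    rw [Finset.sum_range_succ, ih]
    push_cast
    ring

theorem positiveRoot_dotProduct_nonneg {x : V n} (hx : Antitone x) (hnonneg : 0 ≤ x)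
    (q : Fin n × Fin n) : 0 ≤ positiveRoot q ⬝ᵥ x := by
  obtain ⟨a, b⟩ := q
  rw [positiveRoot_dotProduct]
  split_ifs with hab
  · exact sub_nonneg.mpr (hx hab.le)
  · exact add_nonneg (hnonneg a) (hnonneg b)

theorem fundamentalCoweightVec_of_lt {i : ℕ} (hi : i < n) :
    fundamentalCoweightVec n i = fun b : Fin n => if (b : ℕ) < i then 1 else 0 := by
  ext b
  rw [fundamentalCoweightVec, if_pos hi, sum_e_apply]
  rfl

theorem fundamentalCoweightVec_self : fundamentalCoweightVec n n = fun _ => 1 / 2 := by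
  ext b
  rw [fundamentalCoweightVec, if_neg (lt_irrefl n), Pi.smul_apply, sum_e_apply,
    if_pos (Nat.succ_le_of_lt b.2), smul_eq_mul, mul_one]

theorem length_translation_of_eq_ite {i : ℕ} (hi : i ≤ n + 1) {c : ℝ} (hc : 0 ≤ c)
    {p : coweightLattice (n + 1)}
    (hp : p.1 = fun b : Fin (n + 1) => if (b : ℕ) < i then c else 0) :
    (length (translation p) : ℝ) = c * (i * (2 * (n + 1 : ℕ) + 1 - i)) := by
  rw [length_translation, ← sum_positiveRoot_dotProduct_ite hi c, hp]
  refine Finset.sum_congr rfl fun q _ => abs_of_nonneg (positiveRoot_dotProduct_nonneg ?_ ?_ q)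
  · intro a b hab
    have : (a : ℕ) ≤ b := hab
    dsimp only
    split_ifs <;> first | omega | simp
  · intro b
    dsimp only
    split_ifs <;> simp [hc]

theorem length_ω {i : ℕ} (hi : i < n + 1) :
    (length (ω i : ExtAffineWeyl (n + 1)) : ℝ) = i * (2 * (n + 1 : ℕ) + 1 - i) := by
  rw [ω, length_translation_of_eq_ite hi.le zero_le_one (fundamentalCoweightVec_of_lt hi), one_mul]

theorem two_mul_length_ω_self :
    2 * length (ω (n + 1) : ExtAffineWeyl (n + 1)) = (n + 1) * (n + 2) := by
  have hvec : fundamentalCoweightVec (n + 1) (n + 1) =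
      fun b : Fin (n + 1) => if (b : ℕ) < n + 1 then 1 / 2 else 0 := by
    rw [fundamentalCoweightVec_self]
    exact funext fun b => (if_pos b.2).symm
  have hlength := length_translation_of_eq_ite (p := ⟨_, fundamentalCoweightVec_mem _ _⟩) le_rfl
    one_half_pos.le hvec
  rify
  rw [ω, hlength]
  push_cast
  ring

end Length

section Words

/-- The first `n` terms of a sequence, as a vector. Sequences make index arithmetic on coordinates
plain arithmetic in `ℕ`, without bounds; every vector is of this form. -/
def coordVec (n : ℕ) (X : ℕ → ℝ) : V n := fun j => X j

theorem coordVec_surjective : Function.Surjective (coordVec n) := fun x =>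
  ⟨fun j => if h : j < n then x ⟨j, h⟩ else 0, funext fun j => by simp [coordVec]⟩

theorem coordVec_congr {X Y : ℕ → ℝ} (h : ∀ j < n, X j = Y j) : coordVec n X = coordVec n Y :=
  funext fun j => h j j.2

theorem s_zero_smul_coordVec (X : ℕ → ℝ) :
    s (0 : Fin (n + 2)) • coordVec (n + 1) X =
      coordVec (n + 1) fun j => if j = 0 then 1 - X 0 else X j := by
  ext j
  rw [s_zero_smul, Function.update_apply]
  simp only [coordVec, Fin.ext_iff, Fin.val_zero]

theorem s_ofNat_smul_coordVec {k : ℕ} (hk : k < n) (X : ℕ → ℝ) :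
    s (Fin.ofNat (n + 2) (k + 1)) • coordVec (n + 1) X =
      coordVec (n + 1) fun j => if j = k then X (k + 1) else if j = k + 1 then X k else X j := by
  have hlabel : Fin.ofNat (n + 2) (k + 1) = (⟨k, hk⟩ : Fin n).castSucc.succ :=
    Fin.ext (Nat.mod_eq_of_lt (by omega))
  ext j
  rw [hlabel, s_castSucc_succ_smul, Function.comp_apply, Equiv.swap_apply_def]
  simp only [coordVec, Fin.ext_iff, Fin.val_castSucc, Fin.val_succ]
  split_ifs <;> rfl

theorem s_last_smul_coordVec (X : ℕ → ℝ) :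
    s (Fin.last (n + 1)) • coordVec (n + 1) X =
      coordVec (n + 1) fun j => if j = n then -X n else X j := by
  ext j
  rw [s_last_smul, Function.update_apply]
  simp only [coordVec, Fin.ext_iff, Fin.val_last]

theorem seg_eq_cons {k l : ℕ} (hkl : k ≤ l) :
    seg n k l = Fin.ofNat (n + 1) k :: seg n (k + 1) l := by
  rw [seg, seg, show l + 1 - k = (l + 1 - (k + 1)) + 1 by omega, List.range'_succ, List.map_cons]

theorem seg_succ_self (k : ℕ) : seg n (k + 1) k = [] := by
  rw [seg, Nat.sub_self, List.range'_zero, List.map_nil]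

theorem seg_eq_append_last {k : ℕ} (hk : k ≤ n + 1) :
    seg (n + 1) k (n + 1) = seg (n + 1) k n ++ [Fin.last (n + 1)] := by
  have hlabel : Fin.ofNat (n + 2) (k + (n + 1 - k)) = Fin.last (n + 1) := by
    rw [Nat.add_sub_cancel' hk]
    exact Fin.ext (Nat.mod_eq_of_lt (by omega))
  rw [seg, seg, show n + 1 + 1 - k = (n + 1 - k) + 1 by omega, List.range'_concat,
    List.map_append, List.map_singleton, one_mul, hlabel]

theorem length_seg (k l : ℕ) : (seg n k l).length = l + 1 - k := by
  rw [seg, List.length_map, List.length_range']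

theorem wordProd_seg_smul_coordVec {k l : ℕ} (hkl : k ≤ l) (hl : l ≤ n) (X : ℕ → ℝ) :
    wordProd (seg (n + 1) (k + 1) l) • coordVec (n + 1) X =
      coordVec (n + 1) fun j =>
        if j = k then X l else if k < j ∧ j ≤ l then X (j - 1) else X j := by
  induction hkl using Nat.decreasingInduction with
  | self =>
    rw [seg_succ_self, wordProd_nil_smul]
    refine coordVec_congr fun j _ => ?_
    grind
  | of_succ k hkl ih =>
    rw [seg_eq_cons hkl, wordProd_cons, mul_smul, ih, s_ofNat_smul_coordVec (by omega)]
    refine coordVec_congr fun j _ => ?_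
    grind

theorem wordProd_seg_last_smul_coordVec {k : ℕ} (hk : k ≤ n) (X : ℕ → ℝ) :
    wordProd (seg (n + 1) (k + 1) (n + 1)) • coordVec (n + 1) X =
      coordVec (n + 1) fun j => if j = k then -X n else if k < j then X (j - 1) else X j := by
  rw [seg_eq_append_last (by omega), wordProd_append, wordProd_cons, mul_smul, mul_smul,
    wordProd_nil_smul, s_last_smul_coordVec, wordProd_seg_smul_coordVec hk le_rfl]
  refine coordVec_congr fun j _ => ?_
  grind

theorem flatMap_range_sub_succ {α : Type*} (N : ℕ) (f : ℕ → List α) :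
    ((List.range (N + 1)).flatMap fun j => f (N + 1 - j)) =
      f (N + 1) ++ (List.range N).flatMap fun j => f (N - j) := by
  rw [List.range_succ_eq_map, List.flatMap_cons, List.flatMap_map]
  simp only [Nat.sub_zero, Nat.succ_eq_add_one, Nat.add_sub_add_right]

theorem wordProd_flatMap_seg_last_smul_coordVec {N : ℕ} (hN : N ≤ n + 1) (X : ℕ → ℝ) :
    wordProd ((List.range N).flatMap fun j => seg (n + 1) (N - j) (n + 1)) • coordVec (n + 1) X =
      coordVec (n + 1) fun j => if j < N then -X (n - j) else X (j - N) := by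
  induction N with
  | zero =>
    rw [List.range_zero, List.flatMap_nil, wordProd_nil_smul]
    rfl
  | succ N ih =>
    rw [flatMap_range_sub_succ N (fun r => seg (n + 1) r (n + 1)), wordProd_append, mul_smul,
      ih (by omega), wordProd_seg_last_smul_coordVec (by omega)]
    refine coordVec_congr fun j _ => ?_
    grind

theorem wordProd_wordTop_smul (x : V (n + 1)) :
    wordProd (wordTop (n + 1)) • x = fun j => -x j.rev := by
  obtain ⟨X, rfl⟩ := coordVec_surjective x
  rw [wordTop, wordProd_flatMap_seg_last_smul_coordVec le_rfl]
  ext j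
  simp only [coordVec, j.2, if_true, Fin.val_rev]
  congr 2
  omega

theorem wordProd_flatMap_seg_smul_coordVec {i N : ℕ} (hi : 1 ≤ i) (hN : N + i ≤ n + 1)
    (X : ℕ → ℝ) :
    wordProd ((List.range N).flatMap fun j => seg (n + 1) (N - j) (N - j + i - 1)) •
        coordVec (n + 1) X =
      coordVec (n + 1) fun j =>
        if j < N then X (j + i) else if j < N + i then X (j - N) else X j := by
  induction N with
  | zero =>
    rw [List.range_zero, List.flatMap_nil, wordProd_nil_smul]
    refine coordVec_congr fun j _ => ?_
    grind
  | succ N ih =>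
    rw [flatMap_range_sub_succ N (fun r => seg (n + 1) r (r + i - 1)), wordProd_append, mul_smul,
      ih (by omega), wordProd_seg_smul_coordVec (by omega) (by omega)]
    refine coordVec_congr fun j _ => ?_
    grind

theorem wordProd_affineRotation_smul_coordVec (X : ℕ → ℝ) :
    wordProd (0 :: seg (n + 1) 1 (n + 1)) • coordVec (n + 1) X =
      coordVec (n + 1) fun j => if j = 0 then X n + 1 else X (j - 1) := by
  rw [wordProd_cons, mul_smul, wordProd_seg_last_smul_coordVec n.zero_le, s_zero_smul_coordVec]
  refine coordVec_congr fun j _ => ?_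
  grind

theorem wordProd_flatten_replicate_smul_coordVec {i : ℕ} (hi : i ≤ n + 1) (X : ℕ → ℝ) :
    wordProd (List.replicate i (0 :: seg (n + 1) 1 (n + 1))).flatten • coordVec (n + 1) X =
      coordVec (n + 1) fun j => if j < i then X (n + 1 - i + j) + 1 else X (j - i) := by
  induction i with
  | zero =>
    rw [List.replicate_zero, List.flatten_nil, wordProd_nil_smul]
    rfl
  | succ i ih =>
    rw [List.replicate_succ, List.flatten_cons, wordProd_append, mul_smul, ih (by omega),
      wordProd_affineRotation_smul_coordVec]
    refine coordVec_congr fun j _ => ?_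
    grind

theorem wordMid_eq {i : ℕ} (hi : i ≤ n) :
    wordMid n i = (List.replicate i (0 :: seg n 1 n)).flatten ++
      (List.range (n - i)).flatMap fun j => seg n (n - i - j) (n - i - j + i - 1) := by
  rw [wordMid]
  congr 1
  refine List.flatMap_congr fun j hj => ?_
  rw [List.mem_range] at hj
  congr 1
  omega

theorem ω_eq_wordProd_wordMid {i : ℕ} (hi : 1 ≤ i) (hin : i < n + 1) :
    ω i = wordProd (n := n + 1) (wordMid (n + 1) i) := by
  refine eq_of_smul_eq_smul fun x : V (n + 1) => ?_
  obtain ⟨X, rfl⟩ := coordVec_surjective x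
  rw [wordMid_eq hin.le, wordProd_append, mul_smul,
    wordProd_flatMap_seg_smul_coordVec hi (by omega),
    wordProd_flatten_replicate_smul_coordVec hin.le, ω_smul, fundamentalCoweightVec_of_lt hin]
  ext j
  have := j.2
  simp only [coordVec, Pi.add_apply]
  grind

theorem length_wordMid {i : ℕ} (hi : i ≤ n) :
    ((wordMid n i).length : ℝ) = i * (2 * n + 1 - i) := by
  have hflatMap : ((List.range (n - i)).flatMap fun j =>
      seg n (n - i - j) (n - i - j + i - 1)).length = (n - i) * i := by
    rw [List.length_flatMap, List.map_congr_left (g := fun _ => i)]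
    · simp
    · intro j hj
      rw [List.mem_range] at hj
      rw [length_seg]
      omega
  rw [wordMid_eq hi, List.length_append, hflatMap, List.length_flatten, List.map_replicate,
    List.sum_replicate, List.length_cons, length_seg, smul_eq_mul]
  push_cast [hi]
  ring

theorem two_mul_length_wordTop : 2 * (wordTop n).length = n * (n + 1) := by
  have hprefix : ∀ N ≤ n,
      2 * ((List.range N).flatMap fun j => seg n (n - j) n).length = N * (N + 1) := by
    intro N hN
    induction N with
    | zero => rfl
    | succ N ih =>
      rw [List.range_succ, List.flatMap_append, List.length_append, mul_add, ih (by omega),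
        List.flatMap_singleton, length_seg, show n + 1 - (n - N) = N + 1 by omega]
      ring
  exact hprefix n le_rfl

end Words

section Pi

theorem ω_mul_wordTop_inv_smul (x : V (n + 1)) :
    (ω (n + 1) * (wordProd (wordTop (n + 1)))⁻¹) • x = fun j => 1 / 2 - x j.rev := by
  have hinv : (wordProd (wordTop (n + 1)))⁻¹ • x = fun j => -x j.rev := by
    rw [inv_smul_eq_iff, wordProd_wordTop_smul]
    simp only [Fin.rev_rev, neg_neg]
  rw [mul_smul, hinv, ω_smul, fundamentalCoweightVec_self]
  ext j
  simp only [Pi.add_apply]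
  ring

theorem evalAffine_affineSimpleRoot_rev (k : Fin (n + 2)) (x : V (n + 1)) :
    evalAffine (affineSimpleRoot k.rev) (fun j => 1 / 2 - x j.rev) =
      evalAffine (affineSimpleRoot k) x := by
  induction k using label_induction with
  | zero =>
    rw [Fin.rev_zero, evalAffine_affineSimpleRoot_last, evalAffine_affineSimpleRoot_zero,
      Fin.rev_last]
    ring
  | castSucc_succ k =>
    rw [Fin.rev_succ, Fin.rev_castSucc, ← Fin.succ_castSucc,
      evalAffine_affineSimpleRoot_castSucc_succ, evalAffine_affineSimpleRoot_castSucc_succ,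
      Fin.rev_castSucc, Fin.rev_succ, Fin.rev_rev]
    ring
  | last =>
    rw [Fin.rev_last, evalAffine_affineSimpleRoot_last, evalAffine_affineSimpleRoot_zero,
      Fin.rev_zero]
    ring

theorem isPi_iff {g : ExtAffineWeyl (n + 1)} :
    IsPi g ↔ g = ω (n + 1) * (wordProd (wordTop (n + 1)))⁻¹ := by
  simp only [IsPi, act_eq_iff]
  constructor
  · refine fun hg => eq_of_smul_eq_smul fun x : V (n + 1) =>
      eq_of_evalAffine_affineSimpleRoot fun k => ?_
    rw [ω_mul_wordTop_inv_smul, ← k.rev_rev, hg, evalAffine_affineSimpleRoot_rev]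
  · rintro rfl k x
    rw [ω_mul_wordTop_inv_smul, evalAffine_affineSimpleRoot_rev]

theorem mem_Lam_of_isPi {g : ExtAffineWeyl n} (hg : IsPi g) : g ∈ Lam n := by
  change act g '' Set.range affineSimpleRoot = Set.range affineSimpleRoot
  rw [← Set.range_comp, show act g ∘ affineSimpleRoot = affineSimpleRoot ∘ Fin.rev from funext hg]
  exact Fin.rev_surjective.range_comp _

theorem one_mem_Lam : (1 : ExtAffineWeyl n) ∈ Lam n := by
  have act_one (f : V n × ℝ) : act 1 f = f := act_eq_iff.mpr fun x => by rw [one_smul]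
  change act 1 '' _ = _
  simp only [act_one, Set.image_id']

end Pi

section Reduced

theorem isReducedExpression_wordTop {π : ExtAffineWeyl (n + 1)} (hπ : IsPi π) :
    IsReducedExpression (ω (n + 1)) π (wordTop (n + 1)) := by
  refine isReducedExpression_of_length_le (mem_Lam_of_isPi hπ) ?_ ?_
  · rw [isPi_iff.mp hπ, inv_mul_cancel_right]
  · have hword := two_mul_length_wordTop (n := n + 1)
    have hlength := two_mul_length_ω_self (n := n)
    linarith

theorem isReducedExpression_wordMid {i : ℕ} (hi : 1 ≤ i) (hin : i < n + 1) :
    IsReducedExpression (ω i) (1 : ExtAffineWeyl (n + 1)) (wordMid (n + 1) i) := by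
  refine isReducedExpression_of_length_le one_mem_Lam ?_ ?_
  · rw [one_mul, ω_eq_wordProd_wordMid hi hin]
  · rify
    rw [length_wordMid hin.le, length_ω hin]

end Reduced

end TypeC

theorem mainTheorem7 (n : ℕ) (hn : 2 ≤ n) :
    ((∃! π : TypeC.ExtAffineWeyl n, TypeC.IsPi π) ∧
      ∀ π : TypeC.ExtAffineWeyl n, TypeC.IsPi π →
        TypeC.ω n = π * TypeC.wordProd (TypeC.wordTop n) ∧
        TypeC.IsReducedExpression (TypeC.ω n) π (TypeC.wordTop n)) ∧
    ∀ i : ℕ, 1 ≤ i → i < n →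
      TypeC.ω i = TypeC.wordProd (n := n) (TypeC.wordMid n i) ∧
      TypeC.IsReducedExpression (n := n) (TypeC.ω i) 1 (TypeC.wordMid n i) := by
  obtain ⟨n, rfl⟩ : ∃ m, n = m + 1 := ⟨n - 1, by omega⟩
  refine ⟨⟨⟨_, TypeC.isPi_iff.mpr rfl, fun _ hπ => TypeC.isPi_iff.mp hπ⟩, fun π hπ => ?_⟩,
    fun i hi hin => ?_⟩
  · have hreduced := TypeC.isReducedExpression_wordTop hπ
    exact ⟨hreduced.2.1, hreduced⟩
  · exact ⟨TypeC.ω_eq_wordProd_wordMid hi hin, TypeC.isReducedExpression_wordMid hi hin⟩
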